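/- Theorem: A triangulated torus is a finite abstract simplicial complex $K$ that triangulates a closed connected orientable surface of Euler characteristic $0$: every face has at most three vertices, the link of every vertex is a cycle, the $1$-skeleton is connected, the triangles can be oriented coherently, and $f_0 - f_1 + f_2 = 0$, where $f_i$ is the number of $i$-dimensional faces. A linear embedding of $K$ in $\mathbb{R}^3$ is a map $f$ from the vertex set of $K$ to $\mathbb{R}^3$ whose extension $|K| \to \mathbb{R}^3$ to the geometric realization, affine on each face, is injective (straight edges, flat nondegenerate triangles, no self-intersections; coplanar neighboring triangles are allowed). There is no triangulated torus that has a linear embedding in $\mathbb{R}^3$ with all vertices at integer points of the $1 \times 1 \times 2$ cuboid $[0,1] \times [0,1] \times [0,2]$, i.e. in $\{0,1\} \times \{0,1\} \times \{0,1,2\}$. -/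

import Mathlib

namespace TriangulatedSurface

variable {V : Type*}

/-- The 1-skeleton (edge graph) of an abstract simplicial complex. -/
def edgeGraph [DecidableEq V] (K : AbstractSimplicialComplex V) : SimpleGraph V where
  Adj a b := a ≠ b ∧ {a, b} ∈ K.faces
  symm := ⟨fun a b h => ⟨h.1.symm, by rw [Finset.pair_comm]; exact h.2⟩⟩
  loopless := ⟨fun _ h => h.1 rfl⟩

/-- The link of a vertex `v` in a complex of dimension at most two, as a graph: its vertices are the
vertices `a ≠ v` such that `{v, a}` is an edge of `K`, and `a`, `b` are adjacent in it when
`{v, a, b}` is a triangle of `K`. -/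
def linkGraph [DecidableEq V] (K : AbstractSimplicialComplex V) (v : V) :
    SimpleGraph {a : V // a ≠ v ∧ {v, a} ∈ K.faces} where
  Adj a b := a ≠ b ∧ {v, a.1, b.1} ∈ K.faces
  symm := ⟨fun a b h => ⟨h.1.symm, by rw [Finset.pair_comm]; exact h.2⟩⟩
  loopless := ⟨fun _ h => h.1 rfl⟩

/-- `K` is a triangulated closed surface (a combinatorial 2-manifold without boundary): its faces
have at most three vertices, and the link of every vertex is a cycle. -/
structure IsClosedSurface [DecidableEq V] (K : AbstractSimplicialComplex V) : Prop where
  card_le : ∀ s ∈ K.faces, s.card ≤ 3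
  link_cycle : ∀ v : V, ∃ n : ℕ, 3 ≤ n ∧ Nonempty (linkGraph K v ≃g SimpleGraph.cycleGraph n)

/-- Orientability of a triangulated surface: each triangle can be given one of its two orientations
so that adjacent triangles induce opposite directions on their common edge. The sign `σ a b c` says
whether the order `(a, b, c)` of the vertices of a triangle agrees with the chosen orientation. -/
def IsOrientable [DecidableEq V] (K : AbstractSimplicialComplex V) : Prop :=
  ∃ σ : V → V → V → ℤˣ,
    (∀ a b c : V, {a, b, c} ∈ K.faces → ({a, b, c} : Finset V).card = 3 →
      σ b a c = -σ a b c ∧ σ b c a = σ a b c) ∧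
    (∀ a b c d : V, c ≠ d →
      {a, b, c} ∈ K.faces → ({a, b, c} : Finset V).card = 3 →
      {a, b, d} ∈ K.faces → ({a, b, d} : Finset V).card = 3 →
      σ a b d = -σ a b c)

/-- The number of faces with exactly `k` vertices. -/
noncomputable def numFaces (K : AbstractSimplicialComplex V) (k : ℕ) : ℕ :=
  {s : Finset V | s ∈ K.faces ∧ s.card = k}.ncard

/-- The Euler characteristic `#vertices - #edges + #triangles` of a finite complex of dimension at
most two. -/
noncomputable def eulerChar (K : AbstractSimplicialComplex V) : ℤ :=
  (numFaces K 1 : ℤ) - numFaces K 2 + numFaces K 3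

/-- A triangulated torus with vertex set `V`: a connected orientable triangulated closed surface of
Euler characteristic `0`. -/
structure IsTorus [DecidableEq V] (K : AbstractSimplicialComplex V) : Prop where
  closedSurface : IsClosedSurface K
  connected : (edgeGraph K).Connected
  orientable : IsOrientable K
  eulerChar_eq : eulerChar K = 0

/-- The geometric realization `|K|` in barycentric coordinates: convex combinations of the vertices
that are supported on a face of `K`. -/
def realization [Fintype V] (K : AbstractSimplicialComplex V) : Set (V → ℝ) :=
  {x | x ∈ stdSimplex ℝ V ∧ ∃ s ∈ K.faces, ∀ v, v ∉ s → x v = 0}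

/-- The placement `f` of the vertices is a linear embedding (linear realization) of `K` in `ℝ³`: its
extension to `|K|` that is affine on every face is injective. So edges are straight, triangles are
flat and nondegenerate, and there are no self-intersections. -/
def IsLinearEmbedding [Fintype V] (K : AbstractSimplicialComplex V) (f : V → Fin 3 → ℝ) : Prop :=
  Set.InjOn (fun x : V → ℝ => ∑ v, x v • f v) (realization K)

/-- The integer points of the `a × b × c`-cuboid `[0, a] × [0, b] × [0, c]`. -/
def cuboidPoints (a b c : ℕ) : Set (Fin 3 → ℝ) :=
  {p | ∃ x y z : ℕ, x ≤ a ∧ y ≤ b ∧ z ≤ c ∧ p = ![(x : ℝ), (y : ℝ), (z : ℝ)]}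

end TriangulatedSurface

/-! ### Bitmask check over all vertex sets -/

namespace TriangulatedSurface

/-! Double counting gives `3 * f₂ = 2 * f₁`, so Euler characteristic `0` forces `f₁ = 3 * f₀`. The
cuboid has too little room for that many edges: in an embedding, distinct edges have distinct
midpoints and none of these is a vertex, so the edges inject into the half-integer points that are
midpoints of two vertices but not vertices themselves.

This count is sharpened on a vertical `1 × 2` side lacking a vertex at half height. There, edges
with midpoints at `1/4` and `3/4` of the middle line must be the two unit-square diagonals through
the other half-height vertex, and an edge with midpoint at `1/2` must be a long diagonal, which
crosses one of them. So such a side wastes at least one candidate.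

A finite check of the `2 ^ 12` vertex sets shows that the sharpened bound, or `n.choose 2` for small
`n`, stays below `3 * n` for every nonempty set (`allMasks_fewEdges`). The codes are in base `4`, so
neither sums `p + q` nor `p + 2 * q` carry out of the `x` and `y` digits. -/

/-- The codes `x + 4 * y + 16 * z` of the integer points of the `1 × 1 × 2`-cuboid. -/
def cuboidCodes : List ℕ := [0, 1, 4, 5, 16, 17, 20, 21, 32, 33, 36, 37]

/-- The bitwise union of the masks `g c` over those `c` in the list `l` that satisfy `p`, and `r`. -/
def orMask (p : ℕ → Bool) (g : ℕ → ℕ) (l : List ℕ) (r : ℕ) : ℕ :=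
  l.foldl (fun r c => if p c then r ||| g c else r) r

theorem testBit_orMask (p : ℕ → Bool) (g : ℕ → ℕ) (l : List ℕ) (r i : ℕ) :
    (orMask p g l r).testBit i = true ↔
      r.testBit i = true ∨ ∃ c ∈ l, p c = true ∧ (g c).testBit i = true := by
  induction l generalizing r with
  | nil => simp [orMask]
  | cons c l ih =>
    have : orMask p g (c :: l) r = orMask p g l (if p c then r ||| g c else r) := rfl
    rw [this, ih]
    by_cases h : p c <;> simp [h, or_assoc]

/-- Whether `check` holds at all masks that add a set of bits from the list `l` to `r`. -/
def allMasks (check : ℕ → Bool) : List ℕ → ℕ → Bool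
  | [], r => check r
  | c :: l, r => allMasks check l r && allMasks check l (r ||| 2 ^ c)

/-- Each predicate `p` selects one branch of the enumeration, so the computed check applies to the
actual vertex set. -/
theorem check_of_allMasks (check : ℕ → Bool) (p : ℕ → Bool) (l : List ℕ) (r : ℕ)
    (h : allMasks check l r = true) : check (orMask p (2 ^ ·) l r) = true := by
  induction l generalizing r with
  | nil => exact h
  | cons c l ih =>
    have : orMask p (2 ^ ·) (c :: l) r = orMask p (2 ^ ·) l (if p c then r ||| 2 ^ c else r) := rfl
    rw [allMasks, Bool.and_eq_true] at h
    rw [this]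
    split
    · exact ih _ h.2
    · exact ih _ h.1

/-- The mask of the sums of two different elements of the set with mask `m`. -/
def sumMask (m : ℕ) : ℕ :=
  -- As bit `c` of `m` is set, the xor deletes it; shifting by `c` then adds `c` to every other
  -- element.
  orMask m.testBit (fun c => (m ^^^ 2 ^ c) <<< c) cuboidCodes 0

/-- The mask of the doubles of the elements of the set with mask `m`. -/
def doubleMask (m : ℕ) : ℕ := orMask m.testBit (fun c => 2 ^ (2 * c)) cuboidCodes 0

/-- The doubles of the midpoints of two points of the cuboid. -/
def midpointCodes : List ℕ :=
  [0, 1, 2, 4, 5, 6, 8, 9, 10, 16, 17, 18, 20, 21, 22, 24, 25, 26, 32, 33, 34, 36, 37, 38, 40, 41,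
    42, 48, 49, 50, 52, 53, 54, 56, 57, 58, 64, 65, 66, 68, 69, 70, 72, 73, 74]

/-- The mask of the sums of two different elements of the set with mask `m` that are not doubles
of elements of this set. -/
def midpointMask (m : ℕ) : ℕ := sumMask m ^^^ (sumMask m &&& doubleMask m)

/-- The vertical sides of the cuboid, given by the codes of their bottom vertices. -/
def cuboidSides : List (ℕ × ℕ) := [(0, 1), (0, 4), (1, 5), (4, 5)]

/-- The sides with a missing vertex at half height for which the points `1/4`, `1/2`, `3/4` of the
way up their middle line are all among the candidates for midpoints of edges with mask `M`. -/
def obstructedSides (m M : ℕ) : List (ℕ × ℕ) :=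
  cuboidSides.filter fun s =>
    !(m.testBit (s.1 + 16) && m.testBit (s.2 + 16)) &&
      (M.testBit (s.1 + s.2 + 16) && M.testBit (s.1 + s.2 + 32) && M.testBit (s.1 + s.2 + 48))

/-- Whether the `n` vertices with mask `m` have fewer than `3 * n` edges by the midpoint count: each
obstructed side costs at least one of the candidates with mask `M`. -/
def fewMidpoints (m n M : ℕ) : Bool :=
  Nat.blt (midpointCodes.filter M.testBit).length (3 * n + (obstructedSides m M).length)

/-- Whether no admissible graph on the vertex set with mask `m` can have `3` times as many edges as
vertices. -/
def fewEdges (m : ℕ) : Bool :=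
  (fun n => n == 0 || Nat.blt (n.choose 2) (3 * n) || fewMidpoints m n (midpointMask m))
    (cuboidCodes.filter m.testBit).length

theorem allMasks_fewEdges : allMasks fewEdges cuboidCodes 0 = true := by
  decide +kernel
theorem cuboidSides_lt_sixteen : ∀ s ∈ cuboidSides, s.1 + s.2 < 16 := by decide

theorem add_mem_midpointCodes : ∀ p ∈ cuboidCodes, ∀ q ∈ cuboidCodes, p + q ∈ midpointCodes := by
  decide

theorem side_mem_midpointCodes : ∀ s ∈ cuboidSides, ∀ k ∈ [16, 32, 48],
    s.1 + s.2 + k ∈ midpointCodes := by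
  decide

/-- The pairs of vertices of a vertical side of the cuboid whose midpoints are `1/4`, `1/2`, `3/4`
of the way up the middle line of this side. -/
theorem eq_of_add_eq_side : ∀ s ∈ cuboidSides ++ cuboidSides.map Prod.swap,
    ∀ p ∈ cuboidCodes, ∀ q ∈ cuboidCodes,
      (p + q = s.1 + s.2 + 16 → p = s.1 ∧ q = s.2 + 16 ∨ q = s.1 ∧ p = s.2 + 16 ∨
        p = s.1 + 16 ∨ q = s.1 + 16) ∧
      (p + q = s.1 + s.2 + 32 → p = s.1 ∧ q = s.2 + 32 ∨ q = s.1 ∧ p = s.2 + 32 ∨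
        p = s.1 + 32 ∧ q = s.2 ∨ q = s.1 + 32 ∧ p = s.2 ∨ p = s.1 + 16 ∨ q = s.1 + 16) ∧
      (p + q = s.1 + s.2 + 48 → p = s.1 + 32 ∧ q = s.2 + 16 ∨ q = s.1 + 32 ∧ p = s.2 + 16 ∨
        p = s.1 + 16 ∨ q = s.1 + 16) := by
  decide +kernel

theorem testBit_sumMask {m p q : ℕ} (hp : p ∈ cuboidCodes) (hpq : p ≠ q)
    (hmp : m.testBit p = true) (hmq : m.testBit q = true) :
    (sumMask m).testBit (p + q) = true := by
  rw [sumMask, testBit_orMask]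
  refine Or.inr ⟨p, hp, hmp, ?_⟩
  simp [Nat.testBit_shiftLeft, Nat.testBit_xor, hpq, hmq]

theorem exists_of_testBit_doubleMask {m i : ℕ} (h : (doubleMask m).testBit i = true) :
    ∃ p, m.testBit p = true ∧ i = 2 * p := by
  rw [doubleMask, testBit_orMask] at h
  rcases h with h | ⟨p, -, hp, h⟩
  · simp at h
  · exact ⟨p, hp, by simpa [Nat.testBit_two_pow, eq_comm] using h⟩

/-- The sum of the codes of the ends of an edge. -/
def edgeCode {V : Type*} (c : V → ℕ) : Sym2 V → ℕ :=
  Sym2.lift ⟨fun a b => c a + c b, fun a b => add_comm (c a) (c b)⟩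

/-- A coding of the vertices of a graph by points of the `1 × 1 × 2`-cuboid such that different edges
do not share their midpoints, no vertex is the midpoint of an edge, and disjoint edges do not cross at
a third of the way along each. -/
structure IsCuboidCoding {V : Type*} (G : SimpleGraph V) (c : V → ℕ) : Prop where
  injective : Function.Injective c
  mem : ∀ v, c v ∈ cuboidCodes
  edge_eq : ∀ a b u v, G.Adj a b → G.Adj u v → c a + c b = c u + c v → s(a, b) = s(u, v)
  ne_double : ∀ a b u, G.Adj a b → c a + c b ≠ 2 * c u
  ne_third : ∀ a b u v, G.Adj a b → G.Adj u v → c a + 2 * c b = c u + 2 * c v → a = u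

/-! ### Counting edges of a coded graph -/

section

variable {V : Type*} {G : SimpleGraph V} {c : V → ℕ}

theorem mem_edgeSet_image {i : ℕ} (h : i ∈ edgeCode c '' G.edgeSet) :
    ∃ a b, G.Adj a b ∧ c a + c b = i := by
  obtain ⟨e, he, rfl⟩ := h
  induction e with
  | _ a b => exact ⟨a, b, he, rfl⟩

/-- Whichever long diagonal has the central midpoint, it meets one of the short diagonals at a point
two thirds of the way along both, contrary to `ne_third`. -/
theorem IsCuboidCoding.exists_notMem_side (hc : IsCuboidCoding G c) {s : ℕ × ℕ}
    (hs : s ∈ cuboidSides ++ cuboidSides.map Prod.swap) (hmiss : ∀ v, c v ≠ s.1 + 16)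
    (h1 : s.1 + s.2 + 16 ∈ edgeCode c '' G.edgeSet)
    (h2 : s.1 + s.2 + 32 ∈ edgeCode c '' G.edgeSet)
    (h3 : s.1 + s.2 + 48 ∈ edgeCode c '' G.edgeSet) : False := by
  have key := eq_of_add_eq_side s hs
  have e1 : ∃ a b, G.Adj a b ∧ c a = s.1 ∧ c b = s.2 + 16 := by
    obtain ⟨a, b, hab, h⟩ := mem_edgeSet_image h1
    rcases (key _ (hc.mem a) _ (hc.mem b)).1 h with h | h | h | h
    · exact ⟨a, b, hab, h⟩
    · exact ⟨b, a, hab.symm, h⟩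
    · exact (hmiss _ h).elim
    · exact (hmiss _ h).elim
  have e3 : ∃ a b, G.Adj a b ∧ c a = s.1 + 32 ∧ c b = s.2 + 16 := by
    obtain ⟨a, b, hab, h⟩ := mem_edgeSet_image h3
    rcases (key _ (hc.mem a) _ (hc.mem b)).2.2 h with h | h | h | h
    · exact ⟨a, b, hab, h⟩
    · exact ⟨b, a, hab.symm, h⟩
    · exact (hmiss _ h).elim
    · exact (hmiss _ h).elim
  have e2 : ∃ a b, G.Adj a b ∧ (c a = s.1 ∧ c b = s.2 + 32 ∨ c a = s.1 + 32 ∧ c b = s.2) := by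
    obtain ⟨a, b, hab, h⟩ := mem_edgeSet_image h2
    rcases (key _ (hc.mem a) _ (hc.mem b)).2.1 h with h | h | h | h | h | h
    · exact ⟨a, b, hab, Or.inl h⟩
    · exact ⟨b, a, hab.symm, Or.inl h⟩
    · exact ⟨a, b, hab, Or.inr h⟩
    · exact ⟨b, a, hab.symm, Or.inr h⟩
    · exact (hmiss _ h).elim
    · exact (hmiss _ h).elim
  obtain ⟨a, b, hab, ha, hb⟩ := e1
  obtain ⟨a', b', hab', ha', hb'⟩ := e3
  obtain ⟨u, v, huv, ⟨hu, hv⟩ | ⟨hu, hv⟩⟩ := e2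
  · have := hc.ne_third a' b' u v hab' huv (by omega)
    subst this
    omega
  · have := hc.ne_third a b u v hab huv (by omega)
    subst this
    omega

theorem IsCuboidCoding.card_edgeFinset_lt [Fintype V] [Nonempty V] [DecidableEq V]
    [DecidableRel G.Adj] (hc : IsCuboidCoding G c) :
    G.edgeFinset.card < 3 * Fintype.card V := by
  set m := orMask (fun i => decide (∃ v, c v = i)) (2 ^ ·) cuboidCodes 0 with hm
  have hmbit (i : ℕ) : m.testBit i = true ↔ ∃ v, c v = i := by
    rw [hm, testBit_orMask]
    simp only [Nat.zero_testBit, Nat.testBit_two_pow, decide_eq_true_eq]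
    constructor
    · rintro (h | ⟨j, -, hj, rfl⟩)
      · simp at h
      · exact hj
    · rintro ⟨v, rfl⟩
      exact Or.inr ⟨c v, hc.mem v, ⟨v, rfl⟩, rfl⟩
  have hn : (cuboidCodes.filter m.testBit).length = Fintype.card V := by
    have hnodup : (cuboidCodes.filter m.testBit).Nodup := List.Nodup.filter _ (by decide)
    rw [← List.toFinset_card_of_nodup hnodup, ← Finset.card_univ,
      ← Finset.card_image_of_injective Finset.univ hc.injective]
    congr 1
    ext i
    simp only [List.mem_toFinset, List.mem_filter, hmbit, Finset.mem_image, Finset.mem_univ,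
      true_and, and_iff_right_iff_imp]
    rintro ⟨v, rfl⟩
    exact hc.mem v
  have hcheck := check_of_allMasks fewEdges (fun i => decide (∃ v, c v = i)) _ _ allMasks_fewEdges
  rw [← hm] at hcheck
  simp only [fewEdges, hn, Bool.or_eq_true, beq_iff_eq, Nat.blt_eq, or_assoc] at hcheck
  rcases hcheck with h | h | h
  · exact (Fintype.card_ne_zero h).elim
  · exact G.card_edgeFinset_le_card_choose_two.trans_lt h
  rw [fewMidpoints, Nat.blt_eq] at h
  set M := midpointMask m with hM
  have hinj : Set.InjOn (edgeCode c) (G.edgeFinset : Set (Sym2 V)) := by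
    intro e he e' he' h
    induction e with
    | _ a b =>
      induction e' with
      | _ u v => exact hc.edge_eq a b u v (by simpa using he) (by simpa using he') h
  set I := G.edgeFinset.image (edgeCode c) with hI
  have hIcard : I.card = G.edgeFinset.card := Finset.card_image_of_injOn hinj
  have hIset (i : ℕ) : i ∈ I ↔ i ∈ edgeCode c '' G.edgeSet := by simp [hI]
  set U := (midpointCodes.filter M.testBit).toFinset with hU
  have hUcard : U.card ≤ (midpointCodes.filter M.testBit).length := List.toFinset_card_le _
  have hIU : I ⊆ U := by
    intro i hi
    obtain ⟨a, b, hab, rfl⟩ := mem_edgeSet_image ((hIset i).1 hi)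
    simp only [hU, List.mem_toFinset, List.mem_filter]
    refine ⟨add_mem_midpointCodes _ (hc.mem a) _ (hc.mem b), ?_⟩
    have hs := testBit_sumMask (hc.mem a) (hc.injective.ne hab.ne) ((hmbit _).2 ⟨a, rfl⟩)
      ((hmbit _).2 ⟨b, rfl⟩)
    have hd : (doubleMask m).testBit (c a + c b) = false := by
      rw [← Bool.not_eq_true]
      intro hd
      obtain ⟨p, hp, h⟩ := exists_of_testBit_doubleMask hd
      obtain ⟨v, rfl⟩ := (hmbit p).1 hp
      exact hc.ne_double a b v hab h
    simp [hM, midpointMask, Nat.testBit_xor, Nat.testBit_and, hs, hd]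
  have hobs : (obstructedSides m M).length ≤ (U \ I).card := by
    have hnodup : ((obstructedSides m M).map fun s => s.1 + s.2).Nodup := by
      have h : (cuboidSides.map fun s => s.1 + s.2).Nodup := by decide
      exact h.sublist (List.Sublist.map _ List.filter_sublist)
    rw [← List.length_map (f := fun s : ℕ × ℕ => s.1 + s.2),
      ← List.toFinset_card_of_nodup hnodup]
    -- Reduction mod `16` forgets the height of a wasted midpoint and recovers its side, since the
    -- four sums `s.1 + s.2` are distinct and below `16`.
    refine (Finset.card_le_card ?_).trans (Finset.card_image_le (f := (· % 16)))
    intro t ht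
    simp only [List.mem_toFinset, List.mem_map, obstructedSides, List.mem_filter,
      Bool.and_eq_true, Bool.not_eq_true', Bool.and_eq_false_iff] at ht
    obtain ⟨s, ⟨hs, hmiss, ⟨hM1, hM2⟩, hM3⟩, rfl⟩ := ht
    have hlt := cuboidSides_lt_sixteen s hs
    by_contra hcon
    have hall : ∀ k ∈ [16, 32, 48], M.testBit (s.1 + s.2 + k) = true →
        s.1 + s.2 + k ∈ edgeCode c '' G.edgeSet := by
      intro k hk hMk
      rw [← hIset]
      by_contra hkI
      refine hcon (Finset.mem_image.2 ⟨s.1 + s.2 + k, ?_, ?_⟩)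
      · rw [Finset.mem_sdiff, hU, List.mem_toFinset, List.mem_filter]
        exact ⟨⟨side_mem_midpointCodes s hs k hk, hMk⟩, hkI⟩
      · simp only [List.mem_cons, List.not_mem_nil, or_false] at hk
        omega
    have h1 := hall 16 (by simp) hM1
    have h2 := hall 32 (by simp) hM2
    have h3 := hall 48 (by simp) hM3
    have hno {i : ℕ} (hi : m.testBit i = false) (v : V) : c v ≠ i := fun hv => by
      rw [(hmbit i).2 ⟨v, hv⟩] at hi
      cases hi
    rcases hmiss with hmiss | hmiss
    · exact hc.exists_notMem_side (List.mem_append_left _ hs) (hno hmiss) h1 h2 h3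
    -- The missing vertex is above `s.2`, so the side is used with its two edges swapped.
    · rw [add_comm s.1] at h1 h2 h3
      exact hc.exists_notMem_side (s := s.swap)
        (List.mem_append_right _ (List.mem_map_of_mem hs)) (hno hmiss) h1 h2 h3
  have := Finset.card_sdiff_add_card_eq_card hIU
  omega

end

section

variable {V : Type*} {K : AbstractSimplicialComplex V}

theorem numFaces_one [Fintype V] : numFaces K 1 = Fintype.card V := by
  have : {s : Finset V | s ∈ K.faces ∧ s.card = 1} = Set.range (fun v : V => ({v} : Finset V)) := by
    ext s
    simp only [Set.mem_ofPred_eq, Finset.card_eq_one, Set.mem_range]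
    constructor
    · rintro ⟨-, v, rfl⟩
      exact ⟨v, rfl⟩
    · rintro ⟨v, rfl⟩
      exact ⟨K.singleton_mem v, v, rfl⟩
  rw [numFaces, this, ← Set.image_univ, Set.ncard_image_of_injective _ Finset.singleton_injective,
    Set.ncard_univ, Nat.card_eq_fintype_card]

theorem pair_self_mem_faces [DecidableEq V] (v : V) : {v, v} ∈ K.faces := by
  simpa using K.singleton_mem v

variable [Fintype V]

theorem numFaces_eq_card [DecidablePred (· ∈ K.faces)] (k : ℕ) :
    numFaces K k = {s ∈ (Finset.univ : Finset (Finset V)) | s ∈ K.faces ∧ s.card = k}.card := by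
  rw [numFaces, ← Set.ncard_coe_finset]
  simp

/-! ### Midpoints and third points in a linear embedding -/

variable [DecidableEq V]

theorem IsLinearEmbedding.eq_of_combination_eq {f : V → Fin 3 → ℝ} (hf : IsLinearEmbedding K f)
    {a b u v : V} (hab : {a, b} ∈ K.faces) (huv : {u, v} ∈ K.faces) {p q r s : ℝ}
    (hp : 0 ≤ p) (hq : 0 ≤ q) (hr : 0 ≤ r) (hs : 0 ≤ s) (hpq : p + q = 1) (hrs : r + s = 1)
    (h : p • f a + q • f b = r • f u + s • f v) :
    p • (Pi.single a 1 : V → ℝ) + q • Pi.single b 1 =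
      r • Pi.single u 1 + s • Pi.single v 1 := by
  have hmem {a b : V} (hab : {a, b} ∈ K.faces) {p q : ℝ} (hp : 0 ≤ p) (hq : 0 ≤ q)
      (hpq : p + q = 1) :
      p • (Pi.single a 1 : V → ℝ) + q • Pi.single b 1 ∈ realization K := by
    refine ⟨(convex_stdSimplex ℝ V) (single_mem_stdSimplex ℝ a) (single_mem_stdSimplex ℝ b)
      hp hq hpq, _, hab, fun w hw => ?_⟩
    simp only [Finset.mem_insert, Finset.mem_singleton, not_or] at hw
    simp [hw.1, hw.2]
  have hsum (a b : V) (p q : ℝ) :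
      ∑ w, (p • (Pi.single a 1 : V → ℝ) + q • (Pi.single b 1 : V → ℝ)) w • f w = p • f a + q • f b := by
    simp only [Pi.add_apply, Pi.smul_apply, smul_eq_mul, add_smul, mul_smul,
      Finset.sum_add_distrib, ← Finset.smul_sum]
    simp [Pi.single_apply]
  refine hf (hmem hab hp hq hpq) (hmem huv hr hs hrs) ?_
  simp only [hsum, h]

theorem IsLinearEmbedding.pair_eq_of_add_eq {f : V → Fin 3 → ℝ} (hf : IsLinearEmbedding K f)
    {a b u v : V} (hab : {a, b} ∈ K.faces) (huv : {u, v} ∈ K.faces)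
    (h : f a + f b = f u + f v) : s(a, b) = s(u, v) := by
  have key := hf.eq_of_combination_eq hab huv (p := 1 / 2) (q := 1 / 2) (r := 1 / 2) (s := 1 / 2)
    (by norm_num) (by norm_num) (by norm_num) (by norm_num) (by norm_num) (by norm_num)
    (by rw [← smul_add, ← smul_add, h])
  rw [← smul_add, ← smul_add] at key
  replace key := smul_right_injective (V → ℝ) (by norm_num : (1 / 2 : ℝ) ≠ 0) key
  have ha := congrFun key a
  have hb := congrFun key b
  simp only [Pi.add_apply, Pi.single_apply] at ha hb
  rw [Sym2.eq_iff]
  grind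

theorem IsLinearEmbedding.eq_of_add_two_smul_eq {f : V → Fin 3 → ℝ} (hf : IsLinearEmbedding K f)
    {a b u v : V} (hab : {a, b} ∈ K.faces) (huv : {u, v} ∈ K.faces) (hne : a ≠ b)
    (h : f a + (2 : ℝ) • f b = f u + (2 : ℝ) • f v) : a = u := by
  have key := hf.eq_of_combination_eq hab huv (p := 1 / 3) (q := 2 / 3) (r := 1 / 3) (s := 2 / 3)
    (by norm_num) (by norm_num) (by norm_num) (by norm_num) (by norm_num) (by norm_num) (by
      have e (x y : Fin 3 → ℝ) : (1 / 3 : ℝ) • x + (2 / 3 : ℝ) • y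
          = (1 / 3 : ℝ) • (x + (2 : ℝ) • y) := by
        rw [smul_add, smul_smul]; norm_num
      rw [e, e, h])
  -- The coordinate at `a` is `1/3` on the left, but `0` or `2/3` on the right if `a ≠ u`.
  have ha := congrFun key a
  simp only [Pi.add_apply, Pi.smul_apply, Pi.single_apply, smul_eq_mul, if_neg hne] at ha
  by_contra hau
  rw [if_neg hau] at ha
  split_ifs at ha <;> norm_num at ha

theorem IsLinearEmbedding.exists_isCuboidCoding {f : V → Fin 3 → ℝ} (hf : IsLinearEmbedding K f)
    (hc : ∀ v, f v ∈ cuboidPoints 1 1 2) : ∃ c, IsCuboidCoding (edgeGraph K) c := by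
  choose x y z hx hy hz hfv using hc
  have hadd (a b u v : V) (h : x a + 4 * y a + 16 * z a + (x b + 4 * y b + 16 * z b) =
      x u + 4 * y u + 16 * z u + (x v + 4 * y v + 16 * z v)) : f a + f b = f u + f v := by
    have := hx a; have := hx b; have := hx u; have := hx v
    have := hy a; have := hy b; have := hy u; have := hy v
    have h1 : x a + x b = x u + x v := by omega
    have h2 : y a + y b = y u + y v := by omega
    have h3 : z a + z b = z u + z v := by omega
    have h1' : (x a : ℝ) + x b = x u + x v := by exact_mod_cast h1
    have h2' : (y a : ℝ) + y b = y u + y v := by exact_mod_cast h2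
    have h3' : (z a : ℝ) + z b = z u + z v := by exact_mod_cast h3
    ext i
    fin_cases i <;> simp [hfv, h1', h2', h3']
  refine ⟨fun v => x v + 4 * y v + 16 * z v, ?_, fun v => ?_, fun a b u v hab huv h => ?_,
    fun a b u hab h => ?_, fun a b u v hab huv h => ?_⟩
  · intro a b hab
    -- A vertex counts as a degenerate edge that is its own midpoint.
    have h := hf.pair_eq_of_add_eq (pair_self_mem_faces a) (pair_self_mem_faces b)
      (hadd a a b b (by lia))
    simpa using h
  · have := hx v; have := hy v; have := hz v
    interval_cases x v <;> interval_cases y v <;> interval_cases z v <;> decide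
  · exact hf.pair_eq_of_add_eq hab.2 huv.2 (hadd a b u v h)
  · have h := hf.pair_eq_of_add_eq hab.2 (pair_self_mem_faces u)
      (hadd a b u u (by lia))
    rw [Sym2.eq_iff] at h
    exact hab.1 (by grind)
  · refine hf.eq_of_add_two_smul_eq hab.2 huv.2 hab.1 ?_
    have := hx a; have := hx b; have := hx u; have := hx v
    have := hy a; have := hy b; have := hy u; have := hy v
    have h1 : x a + 2 * x b = x u + 2 * x v := by omega
    have h2 : y a + 2 * y b = y u + 2 * y v := by omega
    have h3 : z a + 2 * z b = z u + 2 * z v := by omega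
    have h1' : (x a : ℝ) + 2 * x b = x u + 2 * x v := by exact_mod_cast h1
    have h2' : (y a : ℝ) + 2 * y b = y u + 2 * y v := by exact_mod_cast h2
    have h3' : (z a : ℝ) + 2 * z b = z u + 2 * z v := by exact_mod_cast h3
    ext i
    fin_cases i <;> simp [hfv, h1', h2', h3']

/-! ### Face counts of a torus -/

/-- Triangles containing `{v, a}` correspond to neighbors of `a` in the link of `v`, and a cycle is
2-regular. -/
theorem IsClosedSurface.card_triangles_of_edge (hK : IsClosedSurface K) [DecidablePred (· ∈ K.faces)]
    {e : Finset V} (he : e ∈ K.faces) (hcard : e.card = 2) :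
    {t ∈ (Finset.univ : Finset (Finset V)) | (t ∈ K.faces ∧ t.card = 3) ∧ e ⊆ t}.card = 2 := by
  classical
  obtain ⟨v, a, hva, rfl⟩ := Finset.card_eq_two.1 hcard
  obtain ⟨n, hn, ⟨φ⟩⟩ := hK.link_cycle v
  obtain ⟨n, rfl⟩ := Nat.exists_eq_add_of_le' hn
  let a' : {a : V // a ≠ v ∧ {v, a} ∈ K.faces} := ⟨a, hva.symm, he⟩
  have hdeg : ((linkGraph K v).neighborFinset a').card = 2 := by
    rw [SimpleGraph.card_neighborFinset_eq_degree, ← φ.degree_eq,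
      SimpleGraph.cycleGraph_degree_three_le]
  rw [← hdeg]
  symm
  refine Finset.card_bij (fun b _ => {v, a, b.1}) ?_ ?_ ?_
  · intro b hb
    rw [SimpleGraph.mem_neighborFinset] at hb
    have hab : a ≠ b.1 := fun h => hb.1 (Subtype.ext h)
    simp only [Finset.mem_filter, Finset.mem_univ, true_and]
    refine ⟨⟨hb.2, Finset.card_eq_three.2 ⟨v, a, b.1, hva, b.2.1.symm, hab, rfl⟩⟩, ?_⟩
    intro w hw
    simp only [Finset.mem_insert, Finset.mem_singleton] at hw ⊢
    tauto
  · intro b hb d hd h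
    rw [SimpleGraph.mem_neighborFinset] at hb hd
    have hab : a ≠ b.1 := fun h => hb.1 (Subtype.ext h)
    have hmem : b.1 ∈ ({v, a, d.1} : Finset V) := by
      rw [← h]; simp
    simp only [Finset.mem_insert, Finset.mem_singleton, b.2.1, hab.symm, false_or] at hmem
    exact Subtype.ext hmem
  · intro t ht
    simp only [Finset.mem_filter, Finset.mem_univ, true_and] at ht
    obtain ⟨⟨htK, ht3⟩, hsub⟩ := ht
    have h1 : (t \ {v, a}).card = 1 := by
      rw [Finset.card_sdiff_of_subset hsub, ht3, hcard]
    obtain ⟨b, hb⟩ := Finset.card_eq_one.1 h1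
    have hbt : b ∈ t \ {v, a} := by rw [hb]; simp
    simp only [Finset.mem_sdiff, Finset.mem_insert, Finset.mem_singleton, not_or] at hbt
    have ht : ({v, a, b} : Finset V) = t := by
      refine Finset.eq_of_subset_of_card_le ?_ ?_
      · intro w hw
        simp only [Finset.mem_insert, Finset.mem_singleton] at hw
        rcases hw with rfl | rfl | rfl
        · exact hsub (by simp)
        · exact hsub (by simp)
        · exact hbt.1
      · rw [ht3, Finset.card_eq_three.2 ⟨v, a, b, hva, Ne.symm hbt.2.1, Ne.symm hbt.2.2, rfl⟩]
    have hvb : {v, b} ∈ K.faces := by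
      refine (K.isRelLowerSet_faces htK).2 ?_ (by simp)
      rw [← ht]
      intro w hw
      simp only [Finset.mem_insert, Finset.mem_singleton] at hw ⊢
      tauto
    refine ⟨⟨b, hbt.2.1, hvb⟩, ?_, ht⟩
    rw [SimpleGraph.mem_neighborFinset]
    exact ⟨fun h => hbt.2.2 (congrArg Subtype.val h).symm, by rw [ht]; exact htK⟩

theorem IsClosedSurface.three_mul_numFaces_three (hK : IsClosedSurface K) :
    3 * numFaces K 3 = 2 * numFaces K 2 := by
  classical
  rw [numFaces_eq_card, numFaces_eq_card, mul_comm, mul_comm 2]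
  refine Finset.card_mul_eq_card_mul (fun t e => e ⊆ t) (fun t ht => ?_) (fun e he => ?_)
  · simp only [Finset.mem_filter, Finset.mem_univ, true_and] at ht
    have : Finset.bipartiteAbove (fun t e => e ⊆ t)
        {s ∈ (Finset.univ : Finset (Finset V)) | s ∈ K.faces ∧ s.card = 2} t =
        t.powersetCard 2 := by
      ext e
      simp only [Finset.mem_bipartiteAbove, Finset.mem_filter, Finset.mem_univ, true_and,
        Finset.mem_powersetCard]
      refine ⟨fun h => ⟨h.2, h.1.2⟩, fun h => ⟨⟨(K.isRelLowerSet_faces ht.1).2 h.1 ?_, h.2⟩, h.1⟩⟩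
      exact Finset.card_pos.1 (by omega)
    rw [this, Finset.card_powersetCard, ht.2]
    rfl
  · simp only [Finset.mem_filter, Finset.mem_univ, true_and] at he
    rw [Finset.bipartiteBelow, Finset.filter_filter]
    exact hK.card_triangles_of_edge he.1 he.2

theorem numFaces_two [DecidableRel (edgeGraph K).Adj] :
    numFaces K 2 = (edgeGraph K).edgeFinset.card := by
  classical
  rw [numFaces_eq_card]
  symm
  refine Finset.card_bij (fun e _ => e.toFinset) ?_ ?_ ?_
  · intro e he
    induction e with
    | _ a b =>
      rw [SimpleGraph.mem_edgeFinset, SimpleGraph.mem_edgeSet] at he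
      simp [Sym2.toFinset_mk_eq, he.2, Finset.card_pair he.1]
  · intro e _ e' _ h
    ext v
    rw [← Sym2.mem_toFinset, h, Sym2.mem_toFinset]
  · intro s hs
    simp only [Finset.mem_filter, Finset.mem_univ, true_and] at hs
    obtain ⟨a, b, hab, rfl⟩ := Finset.card_eq_two.1 hs.2
    exact ⟨s(a, b), by simpa using show (edgeGraph K).Adj a b from ⟨hab, hs.1⟩,
      Sym2.toFinset_mk_eq⟩

theorem IsTorus.card_edgeFinset [DecidableRel (edgeGraph K).Adj] (hK : IsTorus K) :
    (edgeGraph K).edgeFinset.card = 3 * Fintype.card V := by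
  have h1 := hK.closedSurface.three_mul_numFaces_three
  have h2 := hK.eulerChar_eq
  rw [eulerChar, numFaces_one] at h2
  rw [← numFaces_two]
  omega

end
end TriangulatedSurface

theorem mainTheorem3 {V : Type*} [Fintype V] [DecidableEq V] (K : AbstractSimplicialComplex V)
    (hK : TriangulatedSurface.IsTorus K) :
    ¬ ∃ f : V → Fin 3 → ℝ, TriangulatedSurface.IsLinearEmbedding K f ∧
      ∀ v : V, f v ∈ TriangulatedSurface.cuboidPoints 1 1 2 := by
  classical
  rintro ⟨f, hf, hcuboid⟩
  obtain ⟨c, hc⟩ := hf.exists_isCuboidCoding hcuboid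
  have := hK.connected.nonempty
  exact hc.card_edgeFinset_lt.ne hK.card_edgeFinset
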